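/- Let $\mathcal{C}$ be a triangulated category with shift functor $[1]$, regarded as an extriangulated category $(\mathcal{C},\mathbb{E},\mathfrak{s})$: $\mathbb{E}(C,A)=\mathcal{C}(C,A[1])$, and $\mathfrak{s}(h)=[A\to B\to C]$ (the class of the sequence up to isomorphisms of $B$ compatible with $\mathrm{id}_A$ and $\mathrm{id}_C$) for every distinguished triangle $A\to B\to C\xrightarrow{h}A[1]$. These data satisfy the axioms of an extriangulated category. Let $\mathcal{N}$ be a full subcategory of $\mathcal{C}$ which is closed under isomorphisms, direct summands and extensions (if $A\to B\to C\to A[1]$ is a distinguished triangle with $A,C\in\mathcal{N}$, then $B\in\mathcal{N}$). For objects $A,C\in\mathcal{C}$ define the following subsets of $\mathbb{E}(C,A)$. (1) $\mathbb{E}^L_{\mathcal{N}}(C,A)$ is the set of all $h\colon C\to A[1]$ satisfying (Lex) for every morphism $x\colon N\to C$ with $N\in\mathcal{N}$, the composite $h\circ x$ factors through an object of $\mathcal{N}[1]$. (2) $\mathbb{E}^R_{\mathcal{N}}(C,A)$ is the set of all $h\colon C\to A[1]$ satisfying (Rex) for every morphism $y\colon A\to N$ with $N\in\mathcal{N}$,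 the composite $y\circ h[-1]\colon C[-1]\to N$ factors through an object of $\mathcal{N}[-1]$ (here $A[1][-1]$ is identified with $A$). An additive subfunctor $\mathbb{F}\subseteq\mathbb{E}$ (subgroups $\mathbb{F}(C,A)\subseteq\mathbb{E}(C,A)$ stable under the maps induced by morphisms in both variables) is called closed if it satisfies the following equivalent conditions: $(\mathcal{C},\mathbb{F},\mathfrak{s}|_{\mathbb{F}})$ is an extriangulated category; the $\mathfrak{s}|_{\mathbb{F}}$-inflations are closed under composition; the $\mathfrak{s}|_{\mathbb{F}}$-deflations are closed under composition. Here an inflation (resp. deflation) is the first (resp. second) morphism of a sequence $A\to B\to C$ that realizes an element of $\mathbb{F}(C,A)$. Then $\mathbb{E}^L_{\mathcal{N}}$, $\mathbb{E}^R_{\mathcal{N}}$ and $\mathbb{E}_{\mathcal{N}}:=\mathbb{E}^L_{\mathcal{N}}\cap\mathbb{E}^R_{\mathcal{N}}$ are closed additive subfunctors of $\mathbb{E}$: each satisfies all three of these conditions. In particular $$(\mathcal{C},\mathbb{E}^L_{\mathcal{N}},\mathfrak{s}|_{\mathbb{E}^L_{\mathcal{N}}}),\qquad (\mathcal{C},\mathbb{E}^R_{\mathcal{N}},\mathfrak{s}|_{\mathbb{E}^R_{\mathcal{N}}}),\qquad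 (\mathcal{C},\mathbb{E}_{\mathcal{N}},\mathfrak{s}|_{\mathbb{E}_{\mathcal{N}}})$$ are extriangulated categories, relative to $(\mathcal{C},\mathbb{E},\mathfrak{s})$. -/

import Mathlib

open CategoryTheory CategoryTheory.Limits CategoryTheory.Pretriangulated Opposite

universe w v u

noncomputable section

namespace Extri

section General

variable {C : Type u} [Category.{v} C]

/-- A sequence `A ⟶ B ⟶ X` with fixed end terms `A` and `X`. -/
structure Seq (A X : C) where
  mid : C
  f : A ⟶ mid
  g : mid ⟶ X

/-- Two sequences with the same end terms are equivalent if there is an isomorphism between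
their middle terms that is compatible with the identities of the end terms. -/
def Seq.Equiv {A X : C} (S T : Seq A X) : Prop :=
  ∃ b : S.mid ≅ T.mid, S.f ≫ b.hom = T.f ∧ b.hom ≫ T.g = S.g

instance seqSetoid (A X : C) : Setoid (Seq A X) where
  r := Seq.Equiv
  iseqv :=
    { refl := fun S => ⟨Iso.refl _, by simp, by simp⟩
      symm := by
        rintro S T ⟨b, h₁, h₂⟩
        exact ⟨b.symm, by simp [← h₁], by simp [← h₂]⟩
      trans := by
        rintro S T U ⟨b, h₁, h₂⟩ ⟨b', h₁', h₂'⟩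
        exact ⟨b ≪≫ b', by simp [← h₁', ← h₁], by simp [h₂', h₂]⟩ }

/-- The equivalence classes `[A ⟶ B ⟶ X]`. -/
abbrev SeqClass (A X : C) : Type (max u v) := Quotient (seqSetoid A X)

/-- The class of the sequence `A ⟶ B ⟶ X` given by `f` and `g`. -/
def seqClass {A B X : C} (f : A ⟶ B) (g : B ⟶ X) : SeqClass A X :=
  Quotient.mk _ ⟨B, f, g⟩

variable (C) in
/-- The data `(𝔼, 𝔰)` of a bifunctor `𝔼 : Cᵒᵖ × C ⥤ Ab` (curried) and a correspondence `𝔰`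
which sends an element of `𝔼(X, A)` to an equivalence class of sequences `A ⟶ B ⟶ X`. -/
structure ExtData where
  E : Cᵒᵖ ⥤ C ⥤ AddCommGrpCat.{w}
  s : ∀ {A X : C}, (E.obj (op X)).obj A → SeqClass A X

namespace ExtData

variable (S : ExtData.{w} C)

/-- The group `𝔼(X, A)` of extensions. -/
abbrev Ext (X A : C) : Type w := (S.E.obj (op X)).obj A

variable {S}

/-- `a_* δ`. -/
def push {X A A' : C} (a : A ⟶ A') (δ : S.Ext X A) : S.Ext X A' :=
  ((S.E.obj (op X)).map a).hom δ

/-- `c^* δ`. -/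
def pull {X X' A : C} (c : X' ⟶ X) (δ : S.Ext X A) : S.Ext X' A :=
  ((S.E.map c.op).app A).hom δ

/-- `𝔰(δ) = [A ⟶ B ⟶ X]`, i.e. `A ⟶ B ⟶ X ⇢` is an `𝔰`-triangle. -/
def Realizes {A B X : C} (f : A ⟶ B) (g : B ⟶ X) (δ : S.Ext X A) : Prop :=
  S.s δ = seqClass f g

variable (S) in
/-- `f` is an `𝔰`-inflation. -/
def IsInflation {A B : C} (f : A ⟶ B) : Prop :=
  ∃ (X : C) (g : B ⟶ X) (δ : S.Ext X A), Realizes f g δ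

variable (S) in
/-- `g` is an `𝔰`-deflation. -/
def IsDeflation {B X : C} (g : B ⟶ X) : Prop :=
  ∃ (A : C) (f : A ⟶ B) (δ : S.Ext X A), Realizes f g δ

variable [Preadditive C] [HasZeroObject C] [HasBinaryBiproducts C]

/-- The extension `δ ⊕ δ'` in `𝔼(X ⊕ X', A ⊕ A')`, which has the components
`δ, 0, 0, δ'` under the decomposition of this group given by additivity. -/
def directSum {X A X' A' : C} (δ : S.Ext X A) (δ' : S.Ext X' A') :
    S.Ext (X ⊞ X') (A ⊞ A') :=
  push biprod.inl (pull biprod.fst δ) + push biprod.inr (pull biprod.snd δ')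

/-- The axioms of an extriangulated category `(C, 𝔼, 𝔰)` on an additive category `C`. -/
structure IsExtriangulated (S : ExtData.{w} C) : Prop where
  /-- (ET1): `𝔼` is additive in the second variable. -/
  additive_right : ∀ X : C, (S.E.obj (op X)).Additive
  /-- (ET1): `𝔼` is additive in the first variable. -/
  additive_left : S.E.Additive
  /-- (ET2): `𝔰` is a realization, i.e. every morphism of extensions lifts to the
  middle terms. -/
  realization : ∀ {A B X A' B' X' : C} {f : A ⟶ B} {g : B ⟶ X} {f' : A' ⟶ B'} {g' : B' ⟶ X'}
    {δ : S.Ext X A} {δ' : S.Ext X' A'}, Realizes f g δ → Realizes f' g' δ' →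
    ∀ (a : A ⟶ A') (c : X ⟶ X'), push a δ = pull c δ' →
      ∃ b : B ⟶ B', f ≫ b = a ≫ f' ∧ g ≫ c = b ≫ g'
  /-- (ET2): the zero extension is realized by the split sequence. -/
  realizes_zero : ∀ A X : C,
    Realizes (biprod.inl : A ⟶ A ⊞ X) (biprod.snd : A ⊞ X ⟶ X) (0 : S.Ext X A)
  /-- (ET2): `𝔰(δ ⊕ δ') = 𝔰(δ) ⊕ 𝔰(δ')`. -/
  realizes_directSum : ∀ {A B X A' B' X' : C} {f : A ⟶ B} {g : B ⟶ X} {f' : A' ⟶ B'}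
    {g' : B' ⟶ X'} {δ : S.Ext X A} {δ' : S.Ext X' A'}, Realizes f g δ → Realizes f' g' δ' →
      Realizes (biprod.map f f') (biprod.map g g') (directSum δ δ')
  /-- (ET3) -/
  et3 : ∀ {A B X A' B' X' : C} {f : A ⟶ B} {g : B ⟶ X} {f' : A' ⟶ B'} {g' : B' ⟶ X'}
    {δ : S.Ext X A} {δ' : S.Ext X' A'}, Realizes f g δ → Realizes f' g' δ' →
    ∀ (a : A ⟶ A') (b : B ⟶ B'), f ≫ b = a ≫ f' →
      ∃ c : X ⟶ X', g ≫ c = b ≫ g' ∧ push a δ = pull c δ'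
  /-- (ET3)ᵒᵖ -/
  et3_op : ∀ {A B X A' B' X' : C} {f : A ⟶ B} {g : B ⟶ X} {f' : A' ⟶ B'} {g' : B' ⟶ X'}
    {δ : S.Ext X A} {δ' : S.Ext X' A'}, Realizes f g δ → Realizes f' g' δ' →
    ∀ (b : B ⟶ B') (c : X ⟶ X'), g ≫ c = b ≫ g' →
      ∃ a : A ⟶ A', f ≫ b = a ≫ f' ∧ push a δ = pull c δ'
  /-- (ET4) -/
  et4 : ∀ {A B D G F : C} {f : A ⟶ B} {f' : B ⟶ D} {g : B ⟶ G} {g' : G ⟶ F}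
    {δ : S.Ext D A} {δ' : S.Ext F B}, Realizes f f' δ → Realizes g g' δ' →
    ∃ (H : C) (h' : G ⟶ H) (d : D ⟶ H) (e : H ⟶ F) (δ'' : S.Ext H A),
      Realizes (f ≫ g) h' δ'' ∧ f' ≫ d = g ≫ h' ∧ h' ≫ e = g' ∧
      Realizes d e (push f' δ') ∧ pull d δ'' = δ ∧ push f δ'' = pull e δ'
  /-- (ET4)ᵒᵖ -/
  et4_op : ∀ {D A B F G : C} {f' : D ⟶ A} {f : A ⟶ B} {g' : F ⟶ B} {g : B ⟶ G}
    {δ : S.Ext B D} {δ' : S.Ext G F}, Realizes f' f δ → Realizes g' g δ' →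
    ∃ (H : C) (h' : H ⟶ A) (d : D ⟶ H) (e : H ⟶ F) (δ'' : S.Ext G H),
      Realizes h' (f ≫ g) δ'' ∧ d ≫ h' = f' ∧ h' ≫ f = e ≫ g' ∧
      Realizes d e (pull g' δ) ∧ push e δ'' = δ' ∧ push d δ = pull g δ''

end ExtData

/-- An additive subfunctor of `𝔼`: subgroups `𝔽(X, A) ⊆ 𝔼(X, A)` that are stable under
`a_*` and `c^*`. -/
structure AddSubfunctor (S : ExtData.{w} C) where
  obj : ∀ X A : C, AddSubgroup (S.Ext X A)
  push_mem : ∀ {X A A' : C} (a : A ⟶ A') {δ : S.Ext X A}, δ ∈ obj X A →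
    ExtData.push a δ ∈ obj X A'
  pull_mem : ∀ {X X' A : C} (c : X' ⟶ X) {δ : S.Ext X A}, δ ∈ obj X A →
    ExtData.pull c δ ∈ obj X' A

namespace AddSubfunctor

variable {S : ExtData.{w} C} (F : AddSubfunctor S)

/-- An additive subfunctor, as a functor in the second variable. -/
def functorObj (X : C) : C ⥤ AddCommGrpCat.{w} where
  obj A := AddCommGrpCat.of (F.obj X A)
  map {A A'} a := AddCommGrpCat.ofHom
    ((((S.E.obj (op X)).map a).hom.comp (F.obj X A).subtype).codRestrict (F.obj X A')
      (fun δ => F.push_mem a δ.2))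
  map_id A := by
    ext δ
    exact congrArg (fun t => t.hom δ.1) ((S.E.obj (op X)).map_id A)
  map_comp a b := by
    ext δ
    exact congrArg (fun t => t.hom δ.1) ((S.E.obj (op X)).map_comp a b)

/-- An additive subfunctor, as a bifunctor. -/
def functor : Cᵒᵖ ⥤ C ⥤ AddCommGrpCat.{w} where
  obj X := F.functorObj X.unop
  map {X X'} c :=
    { app := fun A => AddCommGrpCat.ofHom
        (((((S.E.map c).app A).hom.comp (F.obj X.unop A).subtype)).codRestrict
          (F.obj X'.unop A) (fun δ => F.pull_mem c.unop δ.2))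
      naturality := by
        intro A A' a
        ext δ
        apply Subtype.ext
        exact ConcreteCategory.congr_hom ((S.E.map c).naturality a) δ.1 }
  map_id X := by
    ext A δ
    apply Subtype.ext
    exact congrArg (fun t => (t.app A).hom δ.1) (S.E.map_id X)
  map_comp c d := by
    ext A δ
    apply Subtype.ext
    exact congrArg (fun t => (t.app A).hom δ.1) (S.E.map_comp c d)

/-- The data `(𝔽, 𝔰|_𝔽)`. -/
def restrict : ExtData.{w} C where
  E := F.functor
  s {A X} δ := S.s (A := A) (X := X) ((F.obj X A).subtype δ)

variable [Preadditive C] [HasZeroObject C] [HasBinaryBiproducts C]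

/-- An additive subfunctor `𝔽 ⊆ 𝔼` is closed if `(C, 𝔽, 𝔰|_𝔽)` is an extriangulated category,
equivalently if the `𝔰|_𝔽`-inflations are stable under composition, equivalently if the
`𝔰|_𝔽`-deflations are. All three conditions are required here. -/
structure IsClosed : Prop where
  isExtriangulated : F.restrict.IsExtriangulated
  inflation_comp : ∀ {X Y Z : C} (f : X ⟶ Y) (g : Y ⟶ Z),
    F.restrict.IsInflation f → F.restrict.IsInflation g → F.restrict.IsInflation (f ≫ g)
  deflation_comp : ∀ {X Y Z : C} (f : X ⟶ Y) (g : Y ⟶ Z),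
    F.restrict.IsDeflation f → F.restrict.IsDeflation g → F.restrict.IsDeflation (f ≫ g)

end AddSubfunctor

end General

section Triangulated

variable (C : Type u) [Category.{v} C] [Preadditive C] [HasZeroObject C] [HasShift C ℤ]
  [∀ n : ℤ, (shiftFunctor C n).Additive] [Pretriangulated C]

/-- The bifunctor `𝔼(X, A) = Hom(X, A[1])`. -/
def triangExt : Cᵒᵖ ⥤ C ⥤ AddCommGrpCat.{v} where
  obj X :=
    { obj := fun A => AddCommGrpCat.of (X.unop ⟶ A⟦(1 : ℤ)⟧)
      map := fun a => AddCommGrpCat.ofHom (Preadditive.rightComp X.unop (a⟦(1 : ℤ)⟧'))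
      map_id := fun A => by
        ext (h : X.unop ⟶ A⟦(1 : ℤ)⟧)
        change h ≫ (𝟙 A)⟦(1 : ℤ)⟧' = h
        simp
      map_comp := fun {A A' A''} a b => by
        ext (h : X.unop ⟶ A⟦(1 : ℤ)⟧)
        change h ≫ (a ≫ b)⟦(1 : ℤ)⟧' = (h ≫ a⟦(1 : ℤ)⟧') ≫ b⟦(1 : ℤ)⟧'
        simp }
  map {X X'} c :=
    { app := fun A => AddCommGrpCat.ofHom (Preadditive.leftComp (A⟦(1 : ℤ)⟧) c.unop)
      naturality := fun A A' a => by
        ext (h : X.unop ⟶ A⟦(1 : ℤ)⟧)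
        change c.unop ≫ (h ≫ a⟦(1 : ℤ)⟧') = (c.unop ≫ h) ≫ a⟦(1 : ℤ)⟧'
        simp }
  map_id X := by
    ext A (h : X.unop ⟶ A⟦(1 : ℤ)⟧)
    change 𝟙 X.unop ≫ h = h
    simp
  map_comp {X X' X''} c d := by
    ext A (h : X.unop ⟶ A⟦(1 : ℤ)⟧)
    change (d.unop ≫ c.unop) ≫ h = d.unop ≫ (c.unop ≫ h)
    simp

/-- The extriangulated structure of a triangulated category: `𝔼(X, A) = Hom(X, A[1])`, and
`𝔰(h)` is the class of `A ⟶ B ⟶ X` for a distinguished triangle `A ⟶ B ⟶ X ⟶ A[1]` whose last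
morphism is `h`. By `realizes_iff` below it does not depend on the choice of the triangle. -/
def triangData : ExtData.{v} C where
  E := triangExt C
  s {A X} (h : X ⟶ A⟦(1 : ℤ)⟧) :=
    seqClass (distinguished_cocone_triangle₂ h).choose_spec.choose
      (distinguished_cocone_triangle₂ h).choose_spec.choose_spec.choose

variable {C}

theorem realizes_iff {A B X : C} (f : A ⟶ B) (g : B ⟶ X) (h : X ⟶ A⟦(1 : ℤ)⟧) :
    ExtData.Realizes (S := triangData C) f g h ↔ Triangle.mk f g h ∈ distTriang C := by
  have hT := (distinguished_cocone_triangle₂ h).choose_spec.choose_spec.choose_spec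
  have hc : h ≫ (𝟙 A)⟦(1 : ℤ)⟧' = 𝟙 X ≫ h := by simp
  constructor
  · intro H
    obtain ⟨b, h₁, h₂⟩ := Quotient.exact H
    have e₁ : f ≫ b.inv = 𝟙 A ≫ (distinguished_cocone_triangle₂ h).choose_spec.choose :=
      ((Iso.comp_inv_eq b).2 h₁.symm).trans (Category.id_comp _).symm
    have e₂ : g ≫ 𝟙 X = b.inv ≫
        (distinguished_cocone_triangle₂ h).choose_spec.choose_spec.choose :=
      (Category.comp_id _).trans ((Iso.inv_comp_eq b).2 h₂.symm).symm
    exact isomorphic_distinguished _ hT _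
      (Triangle.isoMk _ _ (Iso.refl A) b.symm (Iso.refl X) e₁ e₂ hc)
  · intro H
    obtain ⟨b, h₁, h₂⟩ := complete_distinguished_triangle_morphism₂ _ _ hT H (𝟙 A) (𝟙 X) hc
    let φ : Triangle.mk _ _ h ⟶ Triangle.mk f g h := ⟨𝟙 A, b, 𝟙 X, h₁, h₂, hc⟩
    have hb : IsIso b := isIso₂_of_isIso₁₃ φ hT H (inferInstanceAs (IsIso (𝟙 A)))
      (inferInstanceAs (IsIso (𝟙 X)))
    exact Quotient.sound ⟨@asIso _ _ _ _ b hb, h₁.trans (Category.id_comp _),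
      h₂.symm.trans (Category.comp_id _)⟩

variable (N : ObjectProperty C)

/-- (Lex): for every `x : M ⟶ X` with `M ∈ N`, the composite `h ∘ x` factors through an
object of `N[1]`. -/
def Lex {X A : C} (h : X ⟶ A⟦(1 : ℤ)⟧) : Prop :=
  ∀ (M : C), N M → ∀ x : M ⟶ X,
    ∃ (M' : C) (_ : N M') (p : M ⟶ M'⟦(1 : ℤ)⟧) (q : M'⟦(1 : ℤ)⟧ ⟶ A⟦(1 : ℤ)⟧), p ≫ q = x ≫ h

/-- (Rex): for every `y : A ⟶ M` with `M ∈ N`, the composite `y ∘ h[-1]`, where `A[1][-1]` is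
identified with `A`, factors through an object of `N[-1]`. -/
def Rex {X A : C} (h : X ⟶ A⟦(1 : ℤ)⟧) : Prop :=
  ∀ (M : C), N M → ∀ y : A ⟶ M,
    ∃ (M' : C) (_ : N M') (p : X⟦(-1 : ℤ)⟧ ⟶ M'⟦(-1 : ℤ)⟧) (q : M'⟦(-1 : ℤ)⟧ ⟶ M),
      p ≫ q = h⟦(-1 : ℤ)⟧' ≫ (shiftShiftNeg A (1 : ℤ)).hom ≫ y

/-- The subset `𝔼^L_N(X, A)` of `𝔼(X, A) = Hom(X, A[1])`. -/
def extL (X A : C) : Set ((triangData C).Ext X A) := {h | Lex N (X := X) (A := A) h}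

/-- The subset `𝔼^R_N(X, A)` of `𝔼(X, A) = Hom(X, A[1])`. -/
def extR (X A : C) : Set ((triangData C).Ext X A) := {h | Rex N (X := X) (A := A) h}

end Triangulated

end Extri

end

/-! The point is that (Lex) is a local vanishing condition. If `x ≫ h` factors through `p : M ⟶
M'⟦1⟧`, the fiber `P` of `p` is an extension of `M` by `M'`, so it lies in `N`, and `h` dies after
pulling back along `P ⟶ M ⟶ X`. Conversely, if `x ≫ h` dies on some `π : P ⟶ M` with fiber in `N`,
it factors through the shift of that fiber. Hence (Lex) says that every map from `N` to `X` can be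
refined, along a map with source and fiber in `N`, until `h` vanishes (`lex_iff`); (Rex) is dual,
with cones (`rex_iff`). By the octahedral axiom and extension closure, refinements compose
(`HasFiberIn.comp`, `HasConeIn.comp`).

Finitely many vanishing conditions can therefore be imposed one after another. This gives closure
under addition. For closedness it suffices that the composed extension `δ''` of an (ET4) or (ET4)ᵒᵖ
diagram inherits the condition from `δ` and `δ'`, as in `IsCompositionStable`: refine once for `δ'`
and once for `δ`, lifting or extending along the triangles in between. The ambient axioms come from
the triangulated structure and pass to such subfunctors. -/

noncomputable section

namespace Extri

/-! ### Closedness of subfunctors via (ET4) diagrams -/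

section General

variable {C : Type u} [Category.{v} C] {S : ExtData.{w} C}

namespace AddSubfunctor

/-- The intersection of two additive subfunctors. -/
def inf (F G : AddSubfunctor S) : AddSubfunctor S where
  obj X A := F.obj X A ⊓ G.obj X A
  push_mem a _ h := ⟨F.push_mem a h.1, G.push_mem a h.2⟩
  pull_mem c _ h := ⟨F.pull_mem c h.1, G.pull_mem c h.2⟩

/-- Membership in `F` passes to the composed extension in every (ET4) and (ET4)ᵒᵖ diagram. -/
structure IsCompositionStable (F : AddSubfunctor S) : Prop where
  inflation : ∀ {A B D G K H : C} {f : A ⟶ B} {f' : B ⟶ D} {g : B ⟶ G} {g' : G ⟶ K}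
    {δ : S.Ext D A} {δ' : S.Ext K B} {h' : G ⟶ H} {d : D ⟶ H} {e : H ⟶ K} {δ'' : S.Ext H A},
    ExtData.Realizes f f' δ → ExtData.Realizes g g' δ' → ExtData.Realizes (f ≫ g) h' δ'' →
    f' ≫ d = g ≫ h' → h' ≫ e = g' → ExtData.Realizes d e (ExtData.push f' δ') →
    ExtData.pull d δ'' = δ → ExtData.push f δ'' = ExtData.pull e δ' →
    δ ∈ F.obj D A → δ' ∈ F.obj K B → δ'' ∈ F.obj H A
  deflation : ∀ {D A B K G H : C} {f' : D ⟶ A} {f : A ⟶ B} {g' : K ⟶ B} {g : B ⟶ G}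
    {δ : S.Ext B D} {δ' : S.Ext G K} {h' : H ⟶ A} {d : D ⟶ H} {e : H ⟶ K} {δ'' : S.Ext G H},
    ExtData.Realizes f' f δ → ExtData.Realizes g' g δ' → ExtData.Realizes h' (f ≫ g) δ'' →
    d ≫ h' = f' → h' ≫ f = e ≫ g' → ExtData.Realizes d e (ExtData.pull g' δ) →
    ExtData.push e δ'' = δ' → ExtData.push d δ = ExtData.pull g δ'' →
    δ ∈ F.obj B D → δ' ∈ F.obj G K → δ'' ∈ F.obj G H

/-- Stability concerns every diagram, not just one chosen diagram, so both subfunctors can be tested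
on the same `δ''`. -/
theorem IsCompositionStable.inf {F G : AddSubfunctor S} (hF : F.IsCompositionStable)
    (hG : G.IsCompositionStable) : (F.inf G).IsCompositionStable where
  inflation r r' r'' c₁ c₂ s c₃ c₄ m m' :=
    ⟨hF.inflation r r' r'' c₁ c₂ s c₃ c₄ m.1 m'.1, hG.inflation r r' r'' c₁ c₂ s c₃ c₄ m.2 m'.2⟩
  deflation r r' r'' c₁ c₂ s c₃ c₄ m m' :=
    ⟨hF.deflation r r' r'' c₁ c₂ s c₃ c₄ m.1 m'.1, hG.deflation r r' r'' c₁ c₂ s c₃ c₄ m.2 m'.2⟩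

variable [Preadditive C] [HasBinaryBiproducts C]

/-- Only (ET4) and (ET4)ᵒᵖ ask for a new extension, and stability puts it in `F`. The other axioms
concern morphisms of `C` and identities between extensions, which can be checked in the ambient
groups. -/
theorem IsCompositionStable.isExtriangulated {F : AddSubfunctor S} (hF : F.IsCompositionStable)
    (hS : S.IsExtriangulated) : F.restrict.IsExtriangulated where
  additive_right X := by
    have := hS.additive_right X
    refine ⟨fun {A A' a b} => ?_⟩
    ext δ
    apply Subtype.ext
    exact congrArg (fun t => t.hom δ.1) ((S.E.obj (op X)).map_add (f := a) (g := b))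
  additive_left := by
    have := hS.additive_left
    refine ⟨fun {X X' a b} => ?_⟩
    ext A δ
    apply Subtype.ext
    exact congrArg (fun t => (t.app A).hom δ.1) (S.E.map_add (f := a) (g := b))
  realization r r' a c h := hS.realization r r' a c (congrArg Subtype.val h)
  realizes_zero A X := hS.realizes_zero A X
  realizes_directSum r r' := hS.realizes_directSum r r'
  et3 r r' a b h := by
    obtain ⟨c, h₁, h₂⟩ := hS.et3 r r' a b h
    exact ⟨c, h₁, Subtype.ext h₂⟩
  et3_op r r' b c h := by
    obtain ⟨a, h₁, h₂⟩ := hS.et3_op r r' b c h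
    exact ⟨a, h₁, Subtype.ext h₂⟩
  et4 {A B D G K f f' g g' δ δ'} r r' := by
    obtain ⟨H, h', d, e, δ'', r'', c₁, c₂, s, c₃, c₄⟩ := hS.et4 r r'
    exact ⟨H, h', d, e, ⟨δ'', hF.inflation r r' r'' c₁ c₂ s c₃ c₄ δ.2 δ'.2⟩, r'', c₁, c₂, s,
      Subtype.ext c₃, Subtype.ext c₄⟩
  et4_op {D A B K G f' f g' g δ δ'} r r' := by
    obtain ⟨H, h', d, e, δ'', r'', c₁, c₂, s, c₃, c₄⟩ := hS.et4_op r r'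
    exact ⟨H, h', d, e, ⟨δ'', hF.deflation r r' r'' c₁ c₂ s c₃ c₄ δ.2 δ'.2⟩, r'', c₁, c₂, s,
      Subtype.ext c₃, Subtype.ext c₄⟩

theorem IsCompositionStable.isClosed {F : AddSubfunctor S} (hF : F.IsCompositionStable)
    (hS : S.IsExtriangulated) : F.IsClosed where
  isExtriangulated := hF.isExtriangulated hS
  inflation_comp := by
    rintro X Y Z f g ⟨D, f', δ, r⟩ ⟨K, g', δ', r'⟩
    obtain ⟨H, h', -, -, δ'', r'', -⟩ := (hF.isExtriangulated hS).et4 r r'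
    exact ⟨H, h', δ'', r''⟩
  deflation_comp := by
    rintro X Y Z f g ⟨D, f', δ, r⟩ ⟨K, g', δ', r'⟩
    obtain ⟨H, h', -, -, δ'', r'', -⟩ := (hF.isExtriangulated hS).et4_op r r'
    exact ⟨H, h', δ'', r''⟩

end AddSubfunctor

end General

/-! ### A triangulated category is extriangulated -/

section Triangulated

variable {C : Type u} [Category.{v} C] [Preadditive C] [HasZeroObject C] [HasShift C ℤ]
  [∀ n : ℤ, (shiftFunctor C n).Additive] [Pretriangulated C]

theorem isIso_piLift_bool (Y : Bool → C) (f : ∀ j, Y true ⊞ Y false ⟶ Y j)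
    (h₁ : f true = biprod.fst) (h₂ : f false = biprod.snd) : IsIso (Pi.lift f) := by
  refine ⟨biprod.lift (Pi.π Y true) (Pi.π Y false), ?_, ?_⟩
  · ext <;> simp [h₁, h₂]
  · ext j
    cases j <;> simp [h₁, h₂]

theorem shift_add_comp_fst {W A A' : C} (a : W ⟶ A⟦(1 : ℤ)⟧) (b : W ⟶ A'⟦(1 : ℤ)⟧) :
    (a ≫ (biprod.inl : A ⟶ A ⊞ A')⟦(1 : ℤ)⟧' + b ≫ (biprod.inr : A' ⟶ A ⊞ A')⟦(1 : ℤ)⟧') ≫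
      (biprod.fst : A ⊞ A' ⟶ A)⟦(1 : ℤ)⟧' = a := by
  simp [← Functor.map_comp]

theorem shift_add_comp_snd {W A A' : C} (a : W ⟶ A⟦(1 : ℤ)⟧) (b : W ⟶ A'⟦(1 : ℤ)⟧) :
    (a ≫ (biprod.inl : A ⟶ A ⊞ A')⟦(1 : ℤ)⟧' + b ≫ (biprod.inr : A' ⟶ A ⊞ A')⟦(1 : ℤ)⟧') ≫
      (biprod.snd : A ⊞ A' ⟶ A')⟦(1 : ℤ)⟧' = b := by
  simp [← Functor.map_comp]

/-- Products of distinguished triangles are distinguished; the projections compare the biproduct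
triangle with the product over `Bool`, and the comparison is invertible on each vertex. -/
theorem biprod_distinguished_bool (T : Bool → Triangle C) (hT : ∀ j, T j ∈ distTriang C) :
    Triangle.mk (biprod.map (T true).mor₁ (T false).mor₁) (biprod.map (T true).mor₂ (T false).mor₂)
      ((biprod.fst ≫ (T true).mor₃) ≫ biprod.inl⟦(1 : ℤ)⟧' +
        (biprod.snd ≫ (T false).mor₃) ≫ biprod.inr⟦(1 : ℤ)⟧') ∈ distTriang C := by
  let T' := Triangle.mk (biprod.map (T true).mor₁ (T false).mor₁)
      (biprod.map (T true).mor₂ (T false).mor₂)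
      ((biprod.fst ≫ (T true).mor₃) ≫ biprod.inl⟦(1 : ℤ)⟧' +
        (biprod.snd ≫ (T false).mor₃) ≫ biprod.inr⟦(1 : ℤ)⟧')
  let p : T' ⟶ T true :=
    { hom₁ := biprod.fst
      hom₂ := biprod.fst
      hom₃ := biprod.fst
      comm₁ := biprod.map_fst _ _
      comm₂ := biprod.map_fst _ _
      comm₃ := shift_add_comp_fst _ _ }
  let q : T' ⟶ T false :=
    { hom₁ := biprod.snd
      hom₂ := biprod.snd
      hom₃ := biprod.snd
      comm₁ := biprod.map_snd _ _
      comm₂ := biprod.map_snd _ _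
      comm₃ := shift_add_comp_snd _ _ }
  let φ : ∀ j, T' ⟶ T j := fun j => match j with
    | true => p
    | false => q
  have h₁ : IsIso (productTriangle.lift T φ).hom₁ :=
    isIso_piLift_bool (fun j => (T j).obj₁) (fun j => (φ j).hom₁) rfl rfl
  have h₂ : IsIso (productTriangle.lift T φ).hom₂ :=
    isIso_piLift_bool (fun j => (T j).obj₂) (fun j => (φ j).hom₂) rfl rfl
  have h₃ : IsIso (productTriangle.lift T φ).hom₃ :=
    isIso_piLift_bool (fun j => (T j).obj₃) (fun j => (φ j).hom₃) rfl rfl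
  have := Triangle.isIso_of_isIsos (productTriangle.lift T φ) h₁ h₂ h₃
  exact isomorphic_distinguished _ (productTriangle_distinguished T hT) _
    (asIso (productTriangle.lift T φ))

theorem biprod_distinguished {A B X A' B' X' : C} {f : A ⟶ B} {g : B ⟶ X} {h : X ⟶ A⟦(1 : ℤ)⟧}
    {f' : A' ⟶ B'} {g' : B' ⟶ X'} {h' : X' ⟶ A'⟦(1 : ℤ)⟧}
    (hT₁ : Triangle.mk f g h ∈ distTriang C) (hT₂ : Triangle.mk f' g' h' ∈ distTriang C) :
    Triangle.mk (biprod.map f f') (biprod.map g g')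
      ((biprod.fst ≫ h) ≫ biprod.inl⟦(1 : ℤ)⟧' +
        (biprod.snd ≫ h') ≫ biprod.inr⟦(1 : ℤ)⟧') ∈ distTriang C :=
  biprod_distinguished_bool (fun j => match j with
    | true => Triangle.mk f g h
    | false => Triangle.mk f' g' h') (fun j => match j with
    | true => hT₁
    | false => hT₂)

/-- The octahedral axiom for a composition of deflations. -/
theorem exists_octahedron_deflation [IsTriangulated C] {D A B K G : C} {f' : D ⟶ A} {f : A ⟶ B}
    {g' : K ⟶ B} {g : B ⟶ G} {δ : B ⟶ D⟦(1 : ℤ)⟧} {δ' : G ⟶ K⟦(1 : ℤ)⟧}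
    (H₁ : Triangle.mk f' f δ ∈ distTriang C) (H₂ : Triangle.mk g' g δ' ∈ distTriang C) :
    ∃ (H : C) (h' : H ⟶ A) (d : D ⟶ H) (e : H ⟶ K) (δ'' : G ⟶ H⟦(1 : ℤ)⟧),
      Triangle.mk h' (f ≫ g) δ'' ∈ distTriang C ∧ d ≫ h' = f' ∧ h' ≫ f = e ≫ g' ∧
      Triangle.mk d e (g' ≫ δ) ∈ distTriang C ∧ δ'' ≫ e⟦(1 : ℤ)⟧' = δ' ∧
      δ ≫ d⟦(1 : ℤ)⟧' = g ≫ δ'' := by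
  -- The octahedron is applied to the composite `g' ≫ δ`, whose cone is `H⟦1⟧`; the cone of `δ` is
  -- `A⟦1⟧`.
  obtain ⟨H, d, e, H₃⟩ := distinguished_cocone_triangle₂ (g' ≫ δ)
  have R₁ : Triangle.mk δ (-f'⟦(1 : ℤ)⟧') (-f⟦(1 : ℤ)⟧') ∈ distTriang C :=
    rot_of_distTriang _ (rot_of_distTriang _ H₁)
  have R₃ : Triangle.mk (g' ≫ δ) (-d⟦(1 : ℤ)⟧') (-e⟦(1 : ℤ)⟧') ∈ distTriang C :=
    rot_of_distTriang _ (rot_of_distTriang _ H₃)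
  let o := Triangulated.someOctahedron rfl H₂ R₁ R₃
  obtain ⟨h', hh'⟩ := (shiftFunctor C (1 : ℤ)).map_surjective o.m₃
  -- The rotated triangle contains `-e⟦1⟧'`, so the sign on `o.m₁` is what makes `δ'' ≫ e⟦1⟧' = δ'`.
  refine ⟨H, h', d, e, -o.m₁, ?_, ?_, ?_, H₃, ?_, ?_⟩
  · rw [Pretriangulated.rotate_distinguished_triangle,
      Pretriangulated.rotate_distinguished_triangle]
    refine isomorphic_distinguished _ o.mem _
      (Triangle.isoMk _ _ (Iso.refl _) (-Iso.refl _) (Iso.refl _) ?_ ?_ ?_)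
    · change (-o.m₁) ≫ (-𝟙 (H⟦(1 : ℤ)⟧)) = 𝟙 G ≫ o.m₁
      simp
    · change (-h'⟦(1 : ℤ)⟧') ≫ 𝟙 (A⟦(1 : ℤ)⟧) = (-𝟙 (H⟦(1 : ℤ)⟧)) ≫ o.m₃
      simp [hh']
    · change (-(f ≫ g)⟦(1 : ℤ)⟧') ≫ (𝟙 G)⟦(1 : ℤ)⟧' =
        𝟙 (A⟦(1 : ℤ)⟧) ≫ (-f⟦(1 : ℤ)⟧') ≫ g⟦(1 : ℤ)⟧'
      simp
  · apply (shiftFunctor C (1 : ℤ)).map_injective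
    have := o.comm₃
    rw [← hh'] at this
    simpa using this
  · apply (shiftFunctor C (1 : ℤ)).map_injective
    have := o.comm₄
    rw [← hh'] at this
    simpa using this.symm
  · simpa using o.comm₂
  · have := o.comm₁
    simp [this]

variable (C) in
-- Through `realizes_iff`, realization and (ET3) become the completion of a morphism of triangles
-- from two of its components, and (ET4) becomes the octahedral axiom.
theorem triangData_isExtriangulated [IsTriangulated C] : (triangData C).IsExtriangulated where
  additive_right X := by
    refine ⟨fun {A A' a b} => ?_⟩
    ext (h : X ⟶ A⟦(1 : ℤ)⟧)
    change h ≫ (a + b)⟦(1 : ℤ)⟧' = h ≫ a⟦(1 : ℤ)⟧' + h ≫ b⟦(1 : ℤ)⟧'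
    simp
  additive_left := by
    refine ⟨fun {X X' a b} => ?_⟩
    ext A (h : X.unop ⟶ A⟦(1 : ℤ)⟧)
    change (a + b).unop ≫ h = a.unop ≫ h + b.unop ≫ h
    simp
  realization r r' a c h := by
    obtain ⟨b, h₁, h₂⟩ := complete_distinguished_triangle_morphism₂ _ _
      ((realizes_iff _ _ _).1 r) ((realizes_iff _ _ _).1 r') a c h
    exact ⟨b, h₁, h₂⟩
  realizes_zero A X := (realizes_iff _ _ _).2 (binaryBiproductTriangle_distinguished A X)
  realizes_directSum r r' := (realizes_iff _ _ _).2
    (biprod_distinguished ((realizes_iff _ _ _).1 r) ((realizes_iff _ _ _).1 r'))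
  et3 r r' a b h := by
    obtain ⟨c, h₁, h₂⟩ := complete_distinguished_triangle_morphism _ _
      ((realizes_iff _ _ _).1 r) ((realizes_iff _ _ _).1 r') a b h
    exact ⟨c, h₁, h₂⟩
  et3_op r r' b c h := by
    obtain ⟨a, h₁, h₂⟩ := complete_distinguished_triangle_morphism₁ _ _
      ((realizes_iff _ _ _).1 r) ((realizes_iff _ _ _).1 r') b c h
    exact ⟨a, h₁, h₂⟩
  et4 {A B D G K f f' g g' δ δ'} r r' := by
    obtain ⟨H, h', δ'', R⟩ := distinguished_cocone_triangle (f ≫ g)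
    let o := Triangulated.someOctahedron rfl ((realizes_iff _ _ _).1 r)
      ((realizes_iff _ _ _).1 r') R
    exact ⟨H, h', o.m₁, o.m₃, δ'', (realizes_iff _ _ _).2 R, o.comm₁, o.comm₃,
      (realizes_iff _ _ _).2 o.mem, o.comm₂, o.comm₄⟩
  et4_op r r' := by
    obtain ⟨H, h', d, e, δ'', h₁, h₂, h₃, h₄, h₅, h₆⟩ := exists_octahedron_deflation
      ((realizes_iff _ _ _).1 r) ((realizes_iff _ _ _).1 r')
    exact ⟨H, h', d, e, δ'', (realizes_iff _ _ _).2 h₁, h₂, h₃, (realizes_iff _ _ _).2 h₄, h₅, h₆⟩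

end Triangulated

/-! ### Functoriality of (Lex) and (Rex) -/

section Shift

variable {C : Type u} [Category.{v} C] [HasShift C ℤ] {N : ObjectProperty C}

/-- The shift is an equivalence, so the factorization may be moved one degree up; this removes the
negative shift and makes (Rex) parallel to (Lex). -/
theorem rex_iff_factors {X A : C} (h : X ⟶ A⟦(1 : ℤ)⟧) :
    Rex N h ↔ ∀ (M : C), N M → ∀ y : A ⟶ M, ∃ (M' : C) (_ : N M') (p : X ⟶ M')
      (q : M' ⟶ M⟦(1 : ℤ)⟧), p ≫ q = h ≫ y⟦(1 : ℤ)⟧' := by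
  refine forall₃_congr fun M _ y => exists₂_congr fun M' _ => ?_
  have hy : y⟦(1 : ℤ)⟧'⟦(-1 : ℤ)⟧' ≫ (shiftShiftNeg M (1 : ℤ)).hom =
      (shiftShiftNeg A (1 : ℤ)).hom ≫ y :=
    (shiftFunctorCompIsoId C (1 : ℤ) (-1) (by simp)).hom.naturality y
  constructor
  · rintro ⟨p, q, hpq⟩
    obtain ⟨p, rfl⟩ := (shiftFunctor C (-1 : ℤ)).map_surjective p
    obtain ⟨q', hq'⟩ := (shiftFunctor C (-1 : ℤ)).map_surjective
      (q ≫ (shiftShiftNeg M (1 : ℤ)).inv)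
    refine ⟨p, q', (shiftFunctor C (-1 : ℤ)).map_injective ?_⟩
    rw [Functor.map_comp, hq', reassoc_of% hpq, Functor.map_comp, ← reassoc_of% hy,
      Iso.hom_inv_id, Category.comp_id]
  · rintro ⟨p, q, hpq⟩
    refine ⟨p⟦(-1 : ℤ)⟧', q⟦(-1 : ℤ)⟧' ≫ (shiftShiftNeg M (1 : ℤ)).hom, ?_⟩
    rw [← Category.assoc, ← Functor.map_comp, hpq, Functor.map_comp, Category.assoc, hy]

theorem Lex.comp_shift {X A A' : C} {h : X ⟶ A⟦(1 : ℤ)⟧} (H : Lex N h) (a : A ⟶ A') :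
    Lex N (h ≫ a⟦(1 : ℤ)⟧') := by
  intro M hM x
  obtain ⟨M', hM', p, q, e⟩ := H M hM x
  exact ⟨M', hM', p, q ≫ a⟦(1 : ℤ)⟧', by rw [reassoc_of% e]⟩

theorem Lex.precomp {X X' A : C} {h : X ⟶ A⟦(1 : ℤ)⟧} (H : Lex N h) (c : X' ⟶ X) :
    Lex N (c ≫ h) := by
  intro M hM x
  obtain ⟨M', hM', p, q, e⟩ := H M hM (x ≫ c)
  exact ⟨M', hM', p, q, by rw [e, Category.assoc]⟩

theorem Rex.comp_shift {X A A' : C} {h : X ⟶ A⟦(1 : ℤ)⟧} (H : Rex N h) (a : A ⟶ A') :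
    Rex N (h ≫ a⟦(1 : ℤ)⟧') := by
  rw [rex_iff_factors] at *
  intro M hM y
  obtain ⟨M', hM', p, q, e⟩ := H M hM (a ≫ y)
  exact ⟨M', hM', p, q, by rw [e, Functor.map_comp, Category.assoc]⟩

theorem Rex.precomp {X X' A : C} {h : X ⟶ A⟦(1 : ℤ)⟧} (H : Rex N h) (c : X' ⟶ X) :
    Rex N (c ≫ h) := by
  rw [rex_iff_factors] at *
  intro M hM y
  obtain ⟨M', hM', p, q, e⟩ := H M hM y
  exact ⟨M', hM', c ≫ p, q, by rw [Category.assoc, e, Category.assoc]⟩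

variable [Preadditive C]

theorem lex_zero (X A : C) : Lex N (0 : X ⟶ A⟦(1 : ℤ)⟧) :=
  fun M hM _ => ⟨M, hM, 0, 0, by simp⟩

theorem Lex.neg {X A : C} {h : X ⟶ A⟦(1 : ℤ)⟧} (H : Lex N h) : Lex N (-h) := by
  intro M hM x
  obtain ⟨M', hM', p, q, e⟩ := H M hM x
  exact ⟨M', hM', p, -q, by simp [e]⟩

theorem rex_zero (X A : C) : Rex N (0 : X ⟶ A⟦(1 : ℤ)⟧) :=
  (rex_iff_factors _).2 fun M hM _ => ⟨M, hM, 0, 0, by simp⟩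

theorem Rex.neg {X A : C} {h : X ⟶ A⟦(1 : ℤ)⟧} (H : Rex N h) : Rex N (-h) := by
  rw [rex_iff_factors] at *
  intro M hM y
  obtain ⟨M', hM', p, q, e⟩ := H M hM y
  exact ⟨M', hM', p, -q, by simp [e]⟩

end Shift

/-! ### Vanishing criteria and stability under composition -/

section Relative

variable {C : Type u} [Category.{v} C] [Preadditive C] [HasZeroObject C] [HasShift C ℤ]
  [∀ n : ℤ, (shiftFunctor C n).Additive] [Pretriangulated C] (N : ObjectProperty C)

/-- `π` is the second morphism of a distinguished triangle whose first object is in `N`. -/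
def HasFiberIn {P M : C} (π : P ⟶ M) : Prop :=
  ∃ (Q : C) (_ : N Q) (i : Q ⟶ P) (w : M ⟶ Q⟦(1 : ℤ)⟧), Triangle.mk i π w ∈ distTriang C

/-- `ι` is the first morphism of a distinguished triangle whose third object is in `N`. -/
def HasConeIn {M P : C} (ι : M ⟶ P) : Prop :=
  ∃ (Q : C) (_ : N Q) (p : P ⟶ Q) (w : Q ⟶ M⟦(1 : ℤ)⟧), Triangle.mk ι p w ∈ distTriang C

variable {N}

theorem exists_lift_of_comp_mor₃_eq_zero {A B X W : C} {f : A ⟶ B} {g : B ⟶ X}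
    {h : X ⟶ A⟦(1 : ℤ)⟧} (T : Triangle.mk f g h ∈ distTriang C) (x : W ⟶ X) (hx : x ≫ h = 0) :
    ∃ l : W ⟶ B, x = l ≫ g :=
  Triangle.coyoneda_exact₃ _ T x hx

theorem exists_lift_of_comp_mor₂_eq_zero {A B X W : C} {f : A ⟶ B} {g : B ⟶ X}
    {h : X ⟶ A⟦(1 : ℤ)⟧} (T : Triangle.mk f g h ∈ distTriang C) (x : W ⟶ B) (hx : x ≫ g = 0) :
    ∃ l : W ⟶ A, x = l ≫ f :=
  Triangle.coyoneda_exact₂ _ T x hx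

theorem exists_desc_of_mor₁_comp_eq_zero {A B X Y : C} {f : A ⟶ B} {g : B ⟶ X}
    {h : X ⟶ A⟦(1 : ℤ)⟧} (T : Triangle.mk f g h ∈ distTriang C) (y : B ⟶ Y) (hy : f ≫ y = 0) :
    ∃ l : X ⟶ Y, y = g ≫ l :=
  Triangle.yoneda_exact₂ _ T y hy

/-- Exactness of `Hom(-, Y⟦1⟧)` on the rotated triangle, then fullness and faithfulness of the
shift; the rotation accounts for the sign. -/
theorem exists_extension_of_shift_comp_eq_zero {A B X Y : C} {f : A ⟶ B} {g : B ⟶ X}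
    {h : X ⟶ A⟦(1 : ℤ)⟧} (T : Triangle.mk f g h ∈ distTriang C) (y : A ⟶ Y)
    (hy : h ≫ y⟦(1 : ℤ)⟧' = 0) : ∃ l : B ⟶ Y, y = f ≫ l := by
  obtain ⟨l', hl'⟩ : ∃ l' : B⟦(1 : ℤ)⟧ ⟶ Y⟦(1 : ℤ)⟧, y⟦(1 : ℤ)⟧' = (-f⟦(1 : ℤ)⟧') ≫ l' :=
    Triangle.yoneda_exact₃ _ (rot_of_distTriang _ T) (y⟦(1 : ℤ)⟧') hy
  obtain ⟨l, rfl⟩ := (shiftFunctor C (1 : ℤ)).map_surjective l'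
  exact ⟨-l, (shiftFunctor C (1 : ℤ)).map_injective (by rw [hl']; simp)⟩

section

variable [N.IsClosedUnderIsomorphisms] [N.IsTriangulatedClosed₂]

theorem lex_iff {X A : C} (h : X ⟶ A⟦(1 : ℤ)⟧) :
    Lex N h ↔ ∀ (M : C), N M → ∀ x : M ⟶ X, ∃ (P : C) (_ : N P) (π : P ⟶ M),
      HasFiberIn N π ∧ π ≫ x ≫ h = 0 := by
  refine forall₃_congr fun M hM x => ⟨?_, ?_⟩
  · rintro ⟨M', hM', p, q, hpq⟩
    -- The refinement is the fiber of `p`, an extension of `M` by `M'`.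
    obtain ⟨P, i, π, hT⟩ := distinguished_cocone_triangle₂ p
    refine ⟨P, N.ext_of_isTriangulatedClosed₂ _ hT hM' hM, π, ⟨M', hM', i, p, hT⟩, ?_⟩
    have hπ : π ≫ p = 0 := comp_distTriang_mor_zero₂₃ _ hT
    rw [← hpq, reassoc_of% hπ, zero_comp]
  · rintro ⟨P, -, π, ⟨Q, hQ, i, w, hT⟩, hπ⟩
    obtain ⟨q, hq⟩ := Triangle.yoneda_exact₃ _ hT (x ≫ h) hπ
    exact ⟨Q, hQ, w, q, hq.symm⟩

theorem rex_iff {X A : C} (h : X ⟶ A⟦(1 : ℤ)⟧) :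
    Rex N h ↔ ∀ (M : C), N M → ∀ y : A ⟶ M, ∃ (P : C) (_ : N P) (ι : M ⟶ P),
      HasConeIn N ι ∧ h ≫ (y ≫ ι)⟦(1 : ℤ)⟧' = 0 := by
  rw [rex_iff_factors]
  refine forall₃_congr fun M hM y => ⟨?_, ?_⟩
  · rintro ⟨M', hM', p, q, hpq⟩
    obtain ⟨P, ι, π, hT⟩ := distinguished_cocone_triangle₂ q
    refine ⟨P, N.ext_of_isTriangulatedClosed₂ _ hT hM hM', ι, ⟨M', hM', π, q, hT⟩, ?_⟩
    have hι : q ≫ ι⟦(1 : ℤ)⟧' = 0 := comp_distTriang_mor_zero₃₁ _ hT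
    rw [Functor.map_comp, ← reassoc_of% hpq, hι, comp_zero]
  · rintro ⟨P, -, ι, ⟨Q, hQ, p, w, hT⟩, hι⟩
    rw [Functor.map_comp, ← Category.assoc] at hι
    obtain ⟨g, hg⟩ := Triangle.coyoneda_exact₁ _ hT (h ≫ y⟦(1 : ℤ)⟧') hι
    exact ⟨Q, hQ, g, w, hg.symm⟩

variable [IsTriangulated C]

/-- By the octahedral axiom the fiber of the composite is an extension of the two fibers. -/
theorem HasFiberIn.comp {P M L : C} {π : P ⟶ M} {π' : M ⟶ L} (h : HasFiberIn N π)
    (h' : HasFiberIn N π') : HasFiberIn N (π ≫ π') := by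
  obtain ⟨Q, hQ, i, w, hT⟩ := h
  obtain ⟨Q', hQ', i', w', hT'⟩ := h'
  obtain ⟨H, j, d, e, δ, hH, -, -, hde, -⟩ := exists_octahedron_deflation hT hT'
  exact ⟨H, N.ext_of_isTriangulatedClosed₂ _ hde hQ hQ', j, δ, hH⟩

theorem HasConeIn.comp {P M L : C} {ι : L ⟶ M} {ι' : M ⟶ P} (h : HasConeIn N ι)
    (h' : HasConeIn N ι') : HasConeIn N (ι ≫ ι') := by
  obtain ⟨Q, hQ, p, w, hT⟩ := h
  obtain ⟨Q', hQ', p', w', hT'⟩ := h'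
  obtain ⟨H, j, δ, hH⟩ := distinguished_cocone_triangle (ι ≫ ι')
  exact ⟨H, N.ext_of_isTriangulatedClosed₂ _ (Triangulated.someOctahedron rfl hT hT' hH).mem
    hQ hQ', j, δ, hH⟩

theorem Lex.add {X A : C} {h h' : X ⟶ A⟦(1 : ℤ)⟧} (H : Lex N h) (H' : Lex N h') :
    Lex N (h + h') := by
  rw [lex_iff] at *
  intro M hM x
  obtain ⟨P, hP, π, hπ, e⟩ := H M hM x
  -- Since `P` is again in `N`, the second condition can be imposed on the first refinement.
  obtain ⟨P', hP', π', hπ', e'⟩ := H' P hP (π ≫ x)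
  refine ⟨P', hP', π' ≫ π, hπ'.comp hπ, ?_⟩
  simp only [Category.assoc] at e'
  simp [e, e']

theorem Rex.add {X A : C} {h h' : X ⟶ A⟦(1 : ℤ)⟧} (H : Rex N h) (H' : Rex N h') :
    Rex N (h + h') := by
  rw [rex_iff] at *
  intro M hM y
  obtain ⟨P, hP, ι, hι, e⟩ := H M hM y
  obtain ⟨P', hP', ι', hι', e'⟩ := H' P hP (y ≫ ι)
  refine ⟨P', hP', ι ≫ ι', hι.comp hι', ?_⟩
  have e'' : h ≫ (y ≫ ι ≫ ι')⟦(1 : ℤ)⟧' = 0 := by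
    rw [← Category.assoc, Functor.map_comp, reassoc_of% e, zero_comp]
  rw [Preadditive.add_comp, e'', ← Category.assoc y, e', add_zero]

theorem Lex.of_inflation_comp {A B D G K H : C} {f : A ⟶ B} {g : B ⟶ G} {g' : G ⟶ K}
    {δ : D ⟶ A⟦(1 : ℤ)⟧} {δ' : K ⟶ B⟦(1 : ℤ)⟧} {h' : G ⟶ H} {d : D ⟶ H} {e : H ⟶ K}
    {δ'' : H ⟶ A⟦(1 : ℤ)⟧} {ε : K ⟶ D⟦(1 : ℤ)⟧} (T' : Triangle.mk g g' δ' ∈ distTriang C)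
    (T'' : Triangle.mk (f ≫ g) h' δ'' ∈ distTriang C) (he : h' ≫ e = g')
    (Tε : Triangle.mk d e ε ∈ distTriang C) (hd : d ≫ δ'' = δ)
    (L : Lex N δ) (L' : Lex N δ') : Lex N δ'' := by
  rw [lex_iff] at *
  intro M hM x
  obtain ⟨P, hP, π, hπ, e₁⟩ := L' M hM (x ≫ e)
  obtain ⟨l, hl⟩ := exists_lift_of_comp_mor₃_eq_zero T' (π ≫ x ≫ e) (by simpa using e₁)
  -- Once `δ'` vanishes, the image in `K` lifts to `l : P ⟶ G`. Subtracting `l ≫ h'`, which `δ''`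
  -- kills, leaves a map that factors through `d`, where `δ''` restricts to `δ`.
  obtain ⟨m, hm⟩ := exists_lift_of_comp_mor₂_eq_zero Tε (π ≫ x - l ≫ h')
    (by simp [hl, he])
  obtain ⟨P', hP', π', hπ', e₂⟩ := L P hP m
  refine ⟨P', hP', π' ≫ π, hπ'.comp hπ, ?_⟩
  have hz : h' ≫ δ'' = 0 := comp_distTriang_mor_zero₂₃ _ T''
  rw [Category.assoc, ← Category.assoc π, sub_eq_iff_eq_add.1 hm]
  simp [hd, e₂, hz]

/-- After two refinements the map from `N` lifts through `g` and then through `f`, and `δ''`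
vanishes on `f ≫ g`. -/
theorem Lex.of_deflation_comp {D A B K G H : C} {f' : D ⟶ A} {f : A ⟶ B} {g' : K ⟶ B} {g : B ⟶ G}
    {δ : B ⟶ D⟦(1 : ℤ)⟧} {δ' : G ⟶ K⟦(1 : ℤ)⟧} {h' : H ⟶ A} {δ'' : G ⟶ H⟦(1 : ℤ)⟧}
    (T : Triangle.mk f' f δ ∈ distTriang C) (T' : Triangle.mk g' g δ' ∈ distTriang C)
    (T'' : Triangle.mk h' (f ≫ g) δ'' ∈ distTriang C) (L : Lex N δ) (L' : Lex N δ') :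
    Lex N δ'' := by
  rw [lex_iff] at *
  intro M hM x
  obtain ⟨P, hP, π, hπ, e₁⟩ := L' M hM x
  obtain ⟨l, hl⟩ := exists_lift_of_comp_mor₃_eq_zero T' (π ≫ x) (by simpa using e₁)
  obtain ⟨P', hP', π', hπ', e₂⟩ := L P hP l
  obtain ⟨m, hm⟩ := exists_lift_of_comp_mor₃_eq_zero T (π' ≫ l) (by simpa using e₂)
  refine ⟨P', hP', π' ≫ π, hπ'.comp hπ, ?_⟩
  have hz : (f ≫ g) ≫ δ'' = 0 := comp_distTriang_mor_zero₂₃ _ T''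
  rw [Category.assoc, reassoc_of% hl, reassoc_of% hm, ← Category.assoc f, hz, comp_zero]

/-- Dually, after two enlargements the map to `N` extends along `f` and then along `g`. -/
theorem Rex.of_inflation_comp {A B D G K H : C} {f : A ⟶ B} {f' : B ⟶ D} {g : B ⟶ G} {g' : G ⟶ K}
    {δ : D ⟶ A⟦(1 : ℤ)⟧} {δ' : K ⟶ B⟦(1 : ℤ)⟧} {h' : G ⟶ H} {δ'' : H ⟶ A⟦(1 : ℤ)⟧}
    (T : Triangle.mk f f' δ ∈ distTriang C) (T' : Triangle.mk g g' δ' ∈ distTriang C)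
    (T'' : Triangle.mk (f ≫ g) h' δ'' ∈ distTriang C) (R : Rex N δ) (R' : Rex N δ') :
    Rex N δ'' := by
  rw [rex_iff] at *
  intro M hM y
  obtain ⟨P, hP, ι, hι, e₁⟩ := R M hM y
  obtain ⟨l, hl⟩ := exists_extension_of_shift_comp_eq_zero T _ e₁
  obtain ⟨P', hP', ι', hι', e₂⟩ := R' P hP l
  obtain ⟨m, hm⟩ := exists_extension_of_shift_comp_eq_zero T' _ e₂
  refine ⟨P', hP', ι ≫ ι', hι.comp hι', ?_⟩
  have hz : δ'' ≫ (f ≫ g)⟦(1 : ℤ)⟧' = 0 := comp_distTriang_mor_zero₃₁ _ T''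
  rw [← Category.assoc, hl, Category.assoc, hm, ← Category.assoc, Functor.map_comp,
    reassoc_of% hz, zero_comp]

theorem Rex.of_deflation_comp {D A B K G H : C} {f' : D ⟶ A} {f : A ⟶ B} {g : B ⟶ G}
    {δ : B ⟶ D⟦(1 : ℤ)⟧} {δ' : G ⟶ K⟦(1 : ℤ)⟧} {h' : H ⟶ A} {d : D ⟶ H} {e : H ⟶ K}
    {δ'' : G ⟶ H⟦(1 : ℤ)⟧} {ε : K ⟶ D⟦(1 : ℤ)⟧} (T : Triangle.mk f' f δ ∈ distTriang C)
    (T'' : Triangle.mk h' (f ≫ g) δ'' ∈ distTriang C) (hd : d ≫ h' = f')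
    (Tε : Triangle.mk d e ε ∈ distTriang C) (he : δ'' ≫ e⟦(1 : ℤ)⟧' = δ')
    (R : Rex N δ) (R' : Rex N δ') : Rex N δ'' := by
  rw [rex_iff] at *
  intro M hM y
  obtain ⟨P, hP, ι, hι, e₁⟩ := R M hM (d ≫ y)
  obtain ⟨l, hl⟩ := exists_extension_of_shift_comp_eq_zero T _ e₁
  -- The extension `l` of `d ≫ y ≫ ι` along `f'` gives the correction `h' ≫ l`, invisible to `δ''`.
  -- The difference vanishes on `d`, so it descends along `e`, which carries `δ''` to `δ'`.
  obtain ⟨m, hm⟩ := exists_desc_of_mor₁_comp_eq_zero Tε (y ≫ ι - h' ≫ l)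
    (by simp [reassoc_of% hd, ← hl])
  obtain ⟨P', hP', ι', hι', e₂⟩ := R' P hP m
  refine ⟨P', hP', ι ≫ ι', hι.comp hι', ?_⟩
  have hz : δ'' ≫ h'⟦(1 : ℤ)⟧' = 0 := comp_distTriang_mor_zero₃₁ _ T''
  rw [← Category.assoc y, sub_eq_iff_eq_add.1 hm, Preadditive.add_comp, Functor.map_add,
    Preadditive.comp_add, Category.assoc, Category.assoc, Functor.map_comp _ e,
    Functor.map_comp _ h', reassoc_of% he, reassoc_of% hz, e₂, zero_comp, add_zero]

variable (N)

/-- The additive subfunctor `𝔼^L_N`. -/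
def lexSubfunctor : AddSubfunctor (triangData C) where
  obj X A :=
    { carrier := extL N X A
      add_mem' := Lex.add
      zero_mem' := lex_zero X A
      neg_mem' := Lex.neg }
  push_mem a _ H := Lex.comp_shift H a
  pull_mem c _ H := Lex.precomp H c

/-- The additive subfunctor `𝔼^R_N`. -/
def rexSubfunctor : AddSubfunctor (triangData C) where
  obj X A :=
    { carrier := extR N X A
      add_mem' := Rex.add
      zero_mem' := rex_zero X A
      neg_mem' := Rex.neg }
  push_mem a _ H := Rex.comp_shift H a
  pull_mem c _ H := Rex.precomp H c

theorem lexSubfunctor_isCompositionStable : (lexSubfunctor N).IsCompositionStable where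
  inflation _ r' r'' _ c₂ s c₃ _ L L' := Lex.of_inflation_comp ((realizes_iff _ _ _).1 r')
    ((realizes_iff _ _ _).1 r'') c₂ ((realizes_iff _ _ _).1 s) c₃ L L'
  deflation r r' r'' _ _ _ _ _ L L' := Lex.of_deflation_comp ((realizes_iff _ _ _).1 r)
    ((realizes_iff _ _ _).1 r') ((realizes_iff _ _ _).1 r'') L L'

theorem rexSubfunctor_isCompositionStable : (rexSubfunctor N).IsCompositionStable where
  inflation r r' r'' _ _ _ _ _ R R' := Rex.of_inflation_comp ((realizes_iff _ _ _).1 r)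
    ((realizes_iff _ _ _).1 r') ((realizes_iff _ _ _).1 r'') R R'
  deflation r _ r'' c₁ _ s c₃ _ R R' := Rex.of_deflation_comp ((realizes_iff _ _ _).1 r)
    ((realizes_iff _ _ _).1 r'') c₁ ((realizes_iff _ _ _).1 s) c₃ R R'

end

end Relative

end Extri

end

theorem proposition2p1 {C : Type u} [Category.{v} C] [Preadditive C] [HasZeroObject C]
    [HasShift C ℤ] [∀ n : ℤ, (shiftFunctor C n).Additive] [Pretriangulated C] [IsTriangulated C]
    (N : ObjectProperty C) [N.IsClosedUnderIsomorphisms] [N.IsStableUnderRetracts]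
    [N.IsTriangulatedClosed₂] :
    (Extri.triangData C).IsExtriangulated ∧
    ∃ FL FR F : Extri.AddSubfunctor (Extri.triangData C),
      (∀ X A : C, (FL.obj X A : Set _) = Extri.extL N X A) ∧
      (∀ X A : C, (FR.obj X A : Set _) = Extri.extR N X A) ∧
      (∀ X A : C, (F.obj X A : Set _) = Extri.extL N X A ∩ Extri.extR N X A) ∧
      FL.IsClosed ∧ FR.IsClosed ∧ F.IsClosed := by
  have hC := Extri.triangData_isExtriangulated C
  have hL := Extri.lexSubfunctor_isCompositionStable N
  have hR := Extri.rexSubfunctor_isCompositionStable N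
  exact ⟨hC, Extri.lexSubfunctor N, Extri.rexSubfunctor N,
    (Extri.lexSubfunctor N).inf (Extri.rexSubfunctor N), fun _ _ => rfl, fun _ _ => rfl,
    fun _ _ => rfl, hL.isClosed hC, hR.isClosed hC, (hL.inf hR).isClosed hC⟩
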